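/- Let $1<p<\infty$ with conjugate exponent $p'$, let $G$ be a locally compact (Hausdorff) group, and let $N$ be a compact normal subgroup of $G$. Then the restriction map $r\colon B_p(G)\to B_p(N)$, $r(u)=u|_N$, is well defined and has dense range for the norm topology of $B_p(N)$: for every $v\in B_p(N)$ and every $\varepsilon>0$ there is $u\in B_p(G)$ with $\|u|_N-v\|_{B_p(N)}<\varepsilon$. Here, for a locally compact group $H$: - A complex Banach space is a $QSL_{p'}$-space if it is isometrically isomorphic to a quotient of a closed subspace of $L^{p'}(X,\mu)$ for some measure space $(X,\mu)$ by a closed subspace. - A representation $(\pi,E)$ of $H$ is a homomorphism $\pi$ from $H$ into the group of invertible linear isometries of a Banach space $E$ that is continuous for the strong operator topology. It is cyclic if there is $v\in E$ such that $\{\int_H f(x)\pi(x)v\,dx : f\in L^1(H)\}$ is dense in $E$. - $B_p(H)$ is the set of all coefficient functions $x\mapsto\langle\pi(x)\xi,\phi\rangle$, with $\xi\in E$ and $\phi\in E^*$, of representations $(\pi,E)$ of $H$ on $QSL_{p'}$-spaces. - The norm of $f$ in $B_p(H)$ is the infimum of $\sum_{n}\|\xi_n\|\,\|\phi_n\|$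 over all expressions $f(x)=\sum_{n\in\mathbb N}\langle\pi_n(x)\xi_n,\phi_n\rangle$ $(x\in H)$ with $\sum_n\|\xi_n\|\,\|\phi_n\|<\infty$, where each $(\pi_n,E_n)$ is a cyclic representation of $H$ on a $QSL_{p'}$-space, $\xi_n\in E_n$ and $\phi_n\in E_n^*$. -/

import Mathlib

open MeasureTheory
open scoped ENNReal

universe u

/-- `E` is a `QSL_q`-space: it is isometrically isomorphic to a quotient `S / T` of a closed
subspace `S` of a (complex) space `L^q(X, μ)` over an arbitrary measure space. -/
def IsQSL (q : ℝ≥0∞) [Fact (1 ≤ q)] (E : Type u) [NormedAddCommGroup E] [NormedSpace ℂ E] : Prop :=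
  ∃ (X : Type u) (_ : MeasurableSpace X) (μ : Measure X) (S : Submodule ℂ (Lp ℂ q μ))
    (T : Submodule ℂ S),
    IsClosed (S : Set (Lp ℂ q μ)) ∧ IsClosed (T : Set S) ∧ Nonempty (E ≃ₗᵢ[ℂ] (S ⧸ T))

/-- A representation of a topological group `G` on a complex Banach space: a homomorphism into
the invertible linear isometries which is continuous for the strong operator topology. -/
structure BanachRep (G : Type u) [Group G] [TopologicalSpace G] : Type (u + 1) where
  E : Type u
  [normedAddCommGroup : NormedAddCommGroup E]
  [normedSpace : NormedSpace ℂ E]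
  [completeSpace : CompleteSpace E]
  toHom : G →* (E ≃ₗᵢ[ℂ] E)
  strongly_continuous : ∀ ξ : E, Continuous fun x : G => toHom x ξ

namespace BanachRep

attribute [instance] normedAddCommGroup normedSpace completeSpace

variable {G : Type u} [Group G] [TopologicalSpace G]

/-- The coefficient function `x ↦ ⟨π(x)ξ, φ⟩`. -/
noncomputable def coeff (π : BanachRep G) (ξ : π.E) (φ : StrongDual ℂ π.E) : G → ℂ :=
  fun x => φ (π.toHom x ξ)

/-- `π ∈ Rep_q(G)`: the representation space is a `QSL_q`-space. -/
def IsRep (q : ℝ≥0∞) [Fact (1 ≤ q)] (π : BanachRep G) : Prop := IsQSL q π.E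

/-- `π` is cyclic: for some `v`, the set `π(L¹(G))v` is dense, where
`π(f)v = ∫ f(x) π(x)v dx` is the integral against (left) Haar measure. -/
def IsCyclic [IsTopologicalGroup G] [LocallyCompactSpace G] (π : BanachRep G) : Prop :=
  letI : MeasurableSpace G := borel G
  haveI : BorelSpace G := ⟨rfl⟩
  ∃ v : π.E, Dense {w : π.E | ∃ f : G → ℂ, Integrable f (Measure.haar : Measure G) ∧
    w = ∫ x, f x • π.toHom x v ∂(Measure.haar : Measure G)}

/-- The restriction of a representation to a subgroup. -/
noncomputable def restrict (π : BanachRep G) (H : Subgroup G) : BanachRep H where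
  E := π.E
  toHom := π.toHom.comp H.subtype
  strongly_continuous ξ := (π.strongly_continuous ξ).comp continuous_subtype_val

/-- The representation on the zero space. -/
noncomputable def zeroRep (G : Type u) [Group G] [TopologicalSpace G] : BanachRep G where
  E := PUnit.{u + 1}
  toHom := 1
  strongly_continuous _ := continuous_const

end BanachRep

/-- The conjugate exponent `p' = 1 + (p - 1)⁻¹` is at least `1`. -/
instance fact_one_le_conjExponent (p : ℝ≥0∞) : Fact (1 ≤ p.conjExponent) :=
  ⟨by simp [ENNReal.conjExponent]⟩

/-- The space `B_p(G)` of all coefficient functions of representations of `G` on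
`QSL_{p'}`-spaces. -/
@[ext]
structure Bp (p : ℝ≥0∞) (G : Type u) [Group G] [TopologicalSpace G] where
  toFun : G → ℂ
  exists_coeff : ∃ π : BanachRep G, π.IsRep p.conjExponent ∧
    ∃ (ξ : π.E) (φ : StrongDual ℂ π.E), toFun = π.coeff ξ φ

/-- The restriction map `r : B_p(G) → B_p(H)`, `r(u) = u|_H`. -/
def Bp.restrict (p : ℝ≥0∞) {G : Type u} [Group G] [TopologicalSpace G] (H : Subgroup G)
    (u : Bp p G) : Bp p H where
  toFun := fun h => u.toFun h
  exists_coeff := by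
    obtain ⟨π, hπ, ξ, φ, h⟩ := u.exists_coeff
    exact ⟨π.restrict H, hπ, ξ, φ, by rw [h]; rfl⟩

theorem isRep_zeroRep {G : Type u} [Group G] [TopologicalSpace G] (q : ℝ≥0∞) [Fact (1 ≤ q)] : (BanachRep.zeroRep G).IsRep q := by
  refine ⟨PUnit, ⊤, 0, ⊥, ⊥, ?_, ?_, ⟨?_⟩⟩
  · simp
  · simp
  · have : Subsingleton (BanachRep.zeroRep G).E := inferInstanceAs (Subsingleton PUnit)
    refine ⟨⟨0, 0, fun _ => Subsingleton.elim _ _, fun y => ?_⟩, fun x => ?_⟩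
    · obtain ⟨s, rfl⟩ := Submodule.Quotient.mk_surjective _ y
      rw [Subsingleton.elim s 0]; simp
    · rw [Subsingleton.elim x 0]; exact norm_zero.trans norm_zero.symm

section Norm

variable {G : Type u} [Group G] [TopologicalSpace G] [IsTopologicalGroup G] [LocallyCompactSpace G]

/-- The set of all numbers `∑ ‖ξₙ‖ ‖φₙ‖ < ∞` coming from expressions
`f(x) = ∑ ⟨πₙ(x)ξₙ, φₙ⟩` with `πₙ ∈ Cyc_{p'}(G)`. -/
def bpNormValues (p : ℝ≥0∞) (f : G → ℂ) : Set ℝ≥0∞ :=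
  {c | ∃ (π : ℕ → BanachRep G) (ξ : ∀ n, (π n).E) (φ : ∀ n, StrongDual ℂ (π n).E),
    (∀ n, (π n).IsRep p.conjExponent ∧ (π n).IsCyclic) ∧
    (∀ x, HasSum (fun n => (π n).coeff (ξ n) (φ n) x) (f x)) ∧
    c = ∑' n, ‖ξ n‖ₑ * ‖φ n‖ₑ ∧ c < ∞}

/-- The norm of `B_p(G)`: the infimum of the above numbers. It is `[0,∞]`-valued, so that a
function without any such expression gets the value `∞`. -/
noncomputable def bpNorm (p : ℝ≥0∞) (f : G → ℂ) : ℝ≥0∞ := sInf (bpNormValues p f)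

theorem isCyclic_zeroRep : (BanachRep.zeroRep G).IsCyclic := by
  have : Subsingleton (BanachRep.zeroRep G).E := inferInstanceAs (Subsingleton PUnit)
  refine ⟨0, fun w => subset_closure ⟨0, integrable_zero _ _ _, Subsingleton.elim _ _⟩⟩

theorem bpNorm_zero (p : ℝ≥0∞) : bpNorm p (0 : G → ℂ) = 0 := by
  refine le_antisymm (sInf_le ⟨fun _ => BanachRep.zeroRep G, fun _ => 0, fun _ => 0,
    fun _ => ⟨isRep_zeroRep _, isCyclic_zeroRep⟩, fun x => ?_, ?_, ?_⟩) zero_le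
  · simp [BanachRep.coeff, hasSum_zero]
  · simp
  · simp

theorem bpNorm_neg_le (p : ℝ≥0∞) (f : G → ℂ) : bpNorm p (-f) ≤ bpNorm p f := by
  refine le_sInf ?_
  rintro c ⟨π, ξ, φ, hπ, hs, hc, hfin⟩
  refine sInf_le ⟨π, ξ, fun n => -φ n, hπ, fun x => ?_, by simpa using hc, hfin⟩
  simpa [BanachRep.coeff] using (hs x).neg

theorem bpNorm_add_le (p : ℝ≥0∞) (f g : G → ℂ) :
    bpNorm p (f + g) ≤ bpNorm p f + bpNorm p g := by
  rw [bpNorm, bpNorm, bpNorm, ENNReal.sInf_add]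
  refine le_iInf₂ fun c hc => ?_
  rw [add_comm c, ENNReal.sInf_add]
  refine le_iInf₂ fun d hd => ?_
  obtain ⟨π, ξ, φ, hπ, hs, hc, hfin⟩ := hc
  obtain ⟨π', ξ', φ', hπ', hs', hd, hfin'⟩ := hd
  let P : ℕ ⊕ ℕ → BanachRep G := Sum.elim π π'
  let X : ∀ i, (P i).E := fun i => match i with
    | Sum.inl n => ξ n
    | Sum.inr n => ξ' n
  let F : ∀ i, StrongDual ℂ (P i).E := fun i => match i with
    | Sum.inl n => φ n
    | Sum.inr n => φ' n
  let e : ℕ ≃ ℕ ⊕ ℕ := Equiv.natSumNatEquivNat.symm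
  refine sInf_le ⟨fun n => P (e n), fun n => X (e n), fun n => F (e n), fun n => ?_, fun x => ?_,
    ?_, ENNReal.add_lt_top.2 ⟨hfin', hfin⟩⟩
  · exact Sum.rec (motive := fun i => (P i).IsRep p.conjExponent ∧ (P i).IsCyclic) hπ hπ' (e n)
  · refine (Equiv.hasSum_iff (f := fun i => (P i).coeff (X i) (F i) x) e).2 ?_
    exact HasSum.sum (hs x) (hs' x)
  · rw [Equiv.tsum_eq e (fun i => ‖X i‖ₑ * ‖F i‖ₑ), hc, hd, add_comm]
    exact (ENNReal.summable.tsum_sum (f := fun i => ‖X i‖ₑ * ‖F i‖ₑ) ENNReal.summable).symm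

/-- The distance `‖f - g‖` on `B_p(G)`, which defines its norm topology. -/
noncomputable instance (p : ℝ≥0∞) : PseudoEMetricSpace (Bp p G) where
  edist f g := bpNorm p (f.toFun - g.toFun)
  edist_self f := by rw [sub_self, bpNorm_zero]
  edist_comm f g := le_antisymm (by simpa using bpNorm_neg_le p (g.toFun - f.toFun))
    (by simpa using bpNorm_neg_le p (f.toFun - g.toFun))
  edist_triangle f g h := by
    simpa using bpNorm_add_le p (f.toFun - g.toFun) (g.toFun - h.toFun)

end Norm

/-!
The proof regularises on `N` and thereby reduces approximation in the norm of `B_p(N)` to uniform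
approximation on `N`.

Write `v = ⟨π(·)ξ, φ⟩` and let `V` be a neighbourhood of the identity in `N`. The averaged function
`v_V(x) = ⨍ y in V, v (x * y)` is the coefficient of `π` at the averaged vector
`⨍ y in V, π(y)ξ`, and this vector tends to `ξ` as `V` shrinks. Since on a compact group a
coefficient has norm at most `‖ξ‖ ‖φ‖` (`bpNorm_coeff_le`), `v_V` is close to `v` in `B_p(N)`. That
bound comes from passing to the closed invariant subspace generated by `ξ`, which is cyclic, and
which is a `QSL`-space because closed subspaces of `QSL`-spaces are (`IsQSL.submodule`).

For fixed `V` the averaging is continuous from the supremum norm to the norm of `B_p(N)`: the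
average of a continuous function `a` is the coefficient of the left regular representation on
`L^{p'}(N)` at the normalised indicator of `V` and at `a ∈ L^p(N)`, so its norm is at most
`C_V sup |a|` (`exists_bpNorm_average_le`).

It remains to find a coefficient `⟨σ(·)η, ψ⟩` of `G` that is uniformly close to `v` on `N`; the left
regular representation on `L^{p'}(G)` provides one (`exists_coeff_approx_on_compact`). Then
`u = ⟨σ(·) ⨍ y in V, σ(y)η, ψ⟩` belongs to `B_p(G)`, and its restriction to `N` is the `V`-average of
the restriction of `⟨σ(·)η, ψ⟩`, hence is close to `v_V` and to `v` in `B_p(N)`.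
-/

/-! ### `QSL`-spaces -/

theorem isQSL_Lp {X : Type u} [MeasurableSpace X] (μ : Measure X) (q : ℝ≥0∞) [Fact (1 ≤ q)] :
    IsQSL q (Lp ℂ q μ) := by
  refine ⟨X, inferInstance, μ, ⊤, ⊥, isClosed_univ, isClosed_singleton, ⟨?_⟩⟩
  let f : Lp ℂ q μ →ₗ[ℂ] ((⊤ : Submodule ℂ (Lp ℂ q μ)) ⧸ (⊥ : Submodule ℂ _)) :=
    (Submodule.mkQ ⊥).comp (LinearEquiv.ofTop ⊤ rfl).symm.toLinearMap
  refine LinearIsometryEquiv.ofSurjective ⟨f, fun x => ?_⟩ fun y => ?_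
  · refine (QuotientAddGroup.norm_mk _).trans ?_
    exact Metric.infDist_singleton.trans (dist_zero_right _)
  · obtain ⟨s, rfl⟩ := Submodule.Quotient.mk_surjective _ y
    exact ⟨s, rfl⟩

/-- A closed subspace of a `QSL`-space is a `QSL`-space: a closed subspace of `S ⧸ T` is `S' ⧸ T`,
where `S'` is its preimage in `S`. -/
theorem IsQSL.submodule {q : ℝ≥0∞} [Fact (1 ≤ q)] {E : Type u} [NormedAddCommGroup E]
    [NormedSpace ℂ E] (h : IsQSL q E) (F : Submodule ℂ E) (hF : IsClosed (F : Set E)) :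
    IsQSL q F := by
  obtain ⟨X, _, μ, S, T, hS, hT, ⟨e⟩⟩ := h
  let P : Submodule ℂ S := F.comap (e.symm.toLinearEquiv.toLinearMap ∘ₗ T.mkQ)
  have hP : IsClosed (P : Set S) :=
    hF.preimage (e.symm.continuous.comp continuous_quot_mk)
  let S' : Submodule ℂ (Lp ℂ q μ) := P.map S.subtype
  have hS' : IsClosed (S' : Set (Lp ℂ q μ)) := hS.isClosedEmbedding_subtypeVal.isClosedMap _ hP
  have hle : S' ≤ S := Submodule.map_subtype_le _ _
  let i : S' →ₗ[ℂ] S := Submodule.inclusion hle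
  have hi : Isometry i := fun _ _ => rfl
  let T' : Submodule ℂ S' := T.comap i
  have hT' : IsClosed (T' : Set S') := hT.preimage hi.continuous
  have hTP : ∀ t ∈ T, t ∈ P := fun t ht => by
    have : T.mkQ t = 0 := by simpa using ht
    change e.symm (T.mkQ t) ∈ F
    rw [this, show e.symm 0 = 0 from e.symm.toLinearEquiv.map_zero]
    exact F.zero_mem
  have himage : i '' (T' : Set S') = T := by
    ext t
    constructor
    · rintro ⟨s, hs, rfl⟩
      exact hs
    · exact fun ht => ⟨⟨t, t, hTP t ht, rfl⟩, ht, rfl⟩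
  let j : S' ⧸ T' →ₗ[ℂ] E := e.symm.toLinearEquiv.toLinearMap ∘ₗ T'.mapQ T i le_rfl
  have hj : ∀ y, ‖j y‖ = ‖y‖ := fun y => by
    obtain ⟨s, rfl⟩ := Submodule.Quotient.mk_surjective _ y
    refine (e.symm.norm_map _).trans ?_
    refine (QuotientAddGroup.norm_mk _).trans (Eq.trans ?_ (QuotientAddGroup.norm_mk _).symm)
    exact (congrArg _ himage.symm).trans (Metric.infDist_image hi)
  have hjF : ∀ y, j y ∈ F := fun y => by
    obtain ⟨⟨_, s, hs, rfl⟩, rfl⟩ := Submodule.Quotient.mk_surjective _ y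
    exact hs
  refine ⟨X, inferInstance, μ, S', T', hS', hT', ⟨LinearIsometryEquiv.symm ?_⟩⟩
  refine LinearIsometryEquiv.ofSurjective ⟨j.codRestrict F hjF, hj⟩ fun ⟨y, hy⟩ => ?_
  obtain ⟨s, hs⟩ := Submodule.Quotient.mk_surjective _ (e y)
  have hsy : e.symm (Submodule.Quotient.mk s) = y := by rw [hs, e.symm_apply_apply]
  exact ⟨Submodule.Quotient.mk ⟨s, s, show e.symm (Submodule.Quotient.mk s) ∈ F from hsy ▸ hy, rfl⟩,
    Subtype.ext hsy⟩

/-! ### Cyclic subrepresentations and the norm of a coefficient -/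

namespace BanachRep

variable {K : Type u} [Group K] [TopologicalSpace K]

/-- The subrepresentation on a closed invariant subspace. -/
noncomputable def subrep (π : BanachRep K) (F : Submodule ℂ π.E) (hF : IsClosed (F : Set π.E))
    (hinv : ∀ x, ∀ ξ ∈ F, π.toHom x ξ ∈ F) : BanachRep K :=
  haveI : CompleteSpace F := hF.completeSpace_coe
  { E := F
    toHom := MonoidHom.mk' (fun x =>
      { toFun := fun ξ => ⟨π.toHom x ξ, hinv x ξ ξ.2⟩
        invFun := fun ξ => ⟨π.toHom x⁻¹ ξ, hinv x⁻¹ ξ ξ.2⟩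
        left_inv := fun ξ => Subtype.ext <| by
          change (π.toHom x⁻¹ * π.toHom x) ξ = ξ
          rw [← map_mul, inv_mul_cancel, map_one]; rfl
        right_inv := fun ξ => Subtype.ext <| by
          change (π.toHom x * π.toHom x⁻¹) ξ = ξ
          rw [← map_mul, mul_inv_cancel, map_one]; rfl
        map_add' := fun ξ η => Subtype.ext (map_add (π.toHom x) ξ.1 η.1)
        map_smul' := fun c ξ => Subtype.ext (map_smul (π.toHom x) c ξ.1)
        norm_map' := fun ξ => (π.toHom x).norm_map ξ.1 })
      fun x y => LinearIsometryEquiv.ext fun ξ => Subtype.ext <| by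
        change π.toHom (x * y) ξ = π.toHom x (π.toHom y ξ)
        rw [map_mul]; rfl
    strongly_continuous := fun ξ => (π.strongly_continuous ξ).subtype_mk _ }

end BanachRep

section Compact

variable {K : Type u} [Group K] [TopologicalSpace K] [IsTopologicalGroup K] [CompactSpace K]
  [MeasurableSpace K] [BorelSpace K]

theorem Continuous.integrable_haar_of_compactSpace {E : Type*} [NormedAddCommGroup E] {f : K → E}
    (hf : Continuous f) : Integrable f (Measure.haar : Measure K) :=
  hf.integrable_of_hasCompactSupport (HasCompactSupport.of_compactSpace _)

namespace BanachRep

theorem integrable_smul_orbit (π : BanachRep K) (ξ : π.E) {f : K → ℂ}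
    (hf : Integrable f (Measure.haar : Measure K)) :
    Integrable (fun x => f x • π.toHom x ξ) (Measure.haar : Measure K) :=
  hf.smul_bdd ‖ξ‖ (π.strongly_continuous ξ).aestronglyMeasurable_of_compactSpace
    (Filter.Eventually.of_forall fun x => ((π.toHom x).norm_map ξ).le)

/-- Averages of an orbit over a neighbourhood of the identity on which the orbit moves little stay
close to the initial vector. -/
theorem norm_average_orbit_sub_le (π : BanachRep K) (ξ : π.E) {ε : ℝ} {V : Set K}
    (hV : MeasurableSet V) (hV0 : (Measure.haar : Measure K) V ≠ 0)
    (h : ∀ y ∈ V, ‖π.toHom y ξ - ξ‖ ≤ ε) :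
    ‖(⨍ y in V, π.toHom y ξ ∂(Measure.haar : Measure K)) - ξ‖ ≤ ε := by
  have := (convex_closedBall ξ ε).set_average_mem Metric.isClosed_closedBall hV0
    (measure_ne_top _ _) ((ae_restrict_iff' hV).2 (Filter.Eventually.of_forall fun y hy =>
      mem_closedBall_iff_norm.2 (h y hy)))
    (π.strongly_continuous ξ).integrable_haar_of_compactSpace.integrableOn
  exact mem_closedBall_iff_norm.1 this

theorem coeff_average_orbit (π : BanachRep K) (ξ : π.E) (φ : StrongDual ℂ π.E) (V : Set K) (x : K) :
    π.coeff (⨍ y in V, π.toHom y ξ ∂(Measure.haar : Measure K)) φ x =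
      ⨍ y in V, π.coeff ξ φ (x * y) ∂(Measure.haar : Measure K) := by
  let L : StrongDual ℂ π.E :=
    φ.comp (π.toHom x).toContinuousLinearEquiv.toContinuousLinearMap
  have h := L.integral_comp_comm
    ((π.strongly_continuous ξ).integrable_haar_of_compactSpace.integrableOn (s := V)).integrable
  change L _ = _
  rw [setAverage_eq, setAverage_eq, L.map_smul_of_tower, ← h]
  simp [L, coeff]

/-- The set `π(L¹(K))ξ`, as a linear subspace. -/
noncomputable def integratedOrbit (π : BanachRep K) (ξ : π.E) : Submodule ℂ π.E where
  carrier := {w | ∃ f : K → ℂ, Integrable f (Measure.haar : Measure K) ∧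
    w = ∫ x, f x • π.toHom x ξ ∂(Measure.haar : Measure K)}
  zero_mem' := ⟨0, integrable_zero _ _ _, by simp⟩
  add_mem' := by
    rintro _ _ ⟨f, hf, rfl⟩ ⟨g, hg, rfl⟩
    refine ⟨f + g, hf.add hg, ?_⟩
    rw [← integral_add (π.integrable_smul_orbit ξ hf) (π.integrable_smul_orbit ξ hg)]
    simp [add_smul]
  smul_mem' := by
    rintro c _ ⟨f, hf, rfl⟩
    refine ⟨c • f, hf.smul c, ?_⟩
    rw [← integral_smul]
    simp [mul_smul]

theorem toHom_mem_integratedOrbit (π : BanachRep K) (ξ : π.E) (y : K) {w : π.E}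
    (hw : w ∈ π.integratedOrbit ξ) : π.toHom y w ∈ π.integratedOrbit ξ := by
  obtain ⟨f, hf, rfl⟩ := hw
  refine ⟨fun x => f (y⁻¹ * x), hf.comp_mul_left _, ?_⟩
  rw [← integral_mul_left_eq_self (fun x => f (y⁻¹ * x) • π.toHom x ξ) y]
  refine ((π.toHom y).toContinuousLinearEquiv.toContinuousLinearMap.integral_comp_comm
    (π.integrable_smul_orbit ξ hf)).symm.trans ?_
  refine integral_congr_ae (Filter.Eventually.of_forall fun x => ?_)
  simp

/-- A vector lies in the closed invariant subspace it generates: normalised indicators of small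
neighbourhoods of the identity form an approximate identity in `L¹(K)`. -/
theorem mem_closure_integratedOrbit (π : BanachRep K) (ξ : π.E) :
    ξ ∈ (π.integratedOrbit ξ).topologicalClosure := by
  refine Metric.mem_closure_iff.2 fun ε hε => ?_
  let V : Set K := (fun y => π.toHom y ξ) ⁻¹' Metric.ball ξ (ε / 2)
  have hVo : IsOpen V := Metric.isOpen_ball.preimage (π.strongly_continuous ξ)
  have hV1 : (1 : K) ∈ V := by simp [V, hε]
  have hV0 : (Measure.haar : Measure K) V ≠ 0 := hVo.measure_ne_zero _ ⟨1, hV1⟩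
  refine ⟨⨍ y in V, π.toHom y ξ ∂(Measure.haar : Measure K),
    ⟨V.indicator fun _ => (((Measure.haar : Measure K).real V)⁻¹ : ℂ),
      (integrable_const _).indicator hVo.measurableSet, ?_⟩, ?_⟩
  · rw [setAverage_eq, ← integral_indicator hVo.measurableSet, ← integral_smul]
    refine integral_congr_ae (Filter.Eventually.of_forall fun x => ?_)
    by_cases hx : x ∈ V
    · simp only [Set.indicator_of_mem hx]
      rw [← Complex.ofReal_inv, Complex.coe_smul]
    · simp [Set.indicator_of_notMem hx]
  · rw [dist_comm, dist_eq_norm]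
    exact (π.norm_average_orbit_sub_le ξ hVo.measurableSet hV0 fun y hy =>
      (mem_ball_iff_norm.1 hy).le).trans_lt (half_lt_self hε)

/-- The closed invariant subspace generated by a vector. -/
noncomputable def cyclicSubrep (π : BanachRep K) (ξ : π.E) : BanachRep K :=
  π.subrep (π.integratedOrbit ξ).topologicalClosure
    (Submodule.isClosed_topologicalClosure _) fun y _ hw =>
      map_mem_closure (π.toHom y).continuous hw fun _ => π.toHom_mem_integratedOrbit ξ y

end BanachRep

end Compact

namespace BanachRep

variable {K : Type u} [Group K] [TopologicalSpace K] [IsTopologicalGroup K] [CompactSpace K]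

/-- Every coefficient of `π` is a coefficient of a cyclic subrepresentation, with the same vector
and the restricted functional. -/
theorem exists_isCyclic_coeff_eq {q : ℝ≥0∞} [Fact (1 ≤ q)] {π : BanachRep K} (hπ : π.IsRep q)
    (ξ : π.E) (φ : StrongDual ℂ π.E) :
    ∃ (σ : BanachRep K) (η : σ.E) (ψ : StrongDual ℂ σ.E), σ.IsRep q ∧ σ.IsCyclic ∧
      σ.coeff η ψ = π.coeff ξ φ ∧ ‖η‖ₑ * ‖ψ‖ₑ ≤ ‖ξ‖ₑ * ‖φ‖ₑ := by
  let _ : MeasurableSpace K := borel K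
  have : BorelSpace K := ⟨rfl⟩
  let F := (π.integratedOrbit ξ).topologicalClosure
  let η : F := ⟨ξ, π.mem_closure_integratedOrbit ξ⟩
  refine ⟨π.cyclicSubrep ξ, η, φ.comp F.subtypeL,
    IsQSL.submodule hπ F (Submodule.isClosed_topologicalClosure _), ⟨η, ?_⟩, rfl, ?_⟩
  · intro w
    refine closure_subtype.2 (closure_mono ?_ w.2)
    rintro _ ⟨f, hf, rfl⟩
    refine ⟨∫ x, f x • (π.cyclicSubrep ξ).toHom x η ∂(Measure.haar : Measure K), ⟨f, hf, rfl⟩, ?_⟩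
    exact (F.subtypeL.integral_comp_comm ((π.cyclicSubrep ξ).integrable_smul_orbit η hf)).symm
  · refine mul_le_mul' le_rfl (enorm_le_iff_norm_le.2 ?_)
    exact ContinuousLinearMap.opNorm_le_bound _ (norm_nonneg _) fun x => φ.le_opNorm x.1

end BanachRep

theorem bpNorm_coeff_le_of_isCyclic {G : Type u} [Group G] [TopologicalSpace G]
    [IsTopologicalGroup G] [LocallyCompactSpace G] {p : ℝ≥0∞} {π : BanachRep G}
    (hπ : π.IsRep p.conjExponent) (hc : π.IsCyclic) (ξ : π.E) (φ : StrongDual ℂ π.E) :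
    bpNorm p (π.coeff ξ φ) ≤ ‖ξ‖ₑ * ‖φ‖ₑ := by
  -- The one-term expression, continued by coefficients of the zero representation.
  let P : ℕ → BanachRep G := fun n => match n with
    | 0 => π
    | _ + 1 => BanachRep.zeroRep G
  let X : ∀ n, (P n).E := fun n => match n with
    | 0 => ξ
    | _ + 1 => 0
  let Φ : ∀ n, StrongDual ℂ (P n).E := fun n => match n with
    | 0 => φ
    | _ + 1 => 0
  refine sInf_le ⟨P, X, Φ, ?_, fun x => ?_, ?_, ENNReal.mul_lt_top enorm_lt_top enorm_lt_top⟩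
  · rintro (_ | n)
    exacts [⟨hπ, hc⟩, ⟨isRep_zeroRep _, isCyclic_zeroRep⟩]
  · refine hasSum_single (f := fun n => (P n).coeff (X n) (Φ n) x) 0 ?_
    rintro (_ | n) hn
    exacts [absurd rfl hn, rfl]
  · refine (tsum_eq_single (f := fun n => ‖X n‖ₑ * ‖Φ n‖ₑ) 0 ?_).symm
    rintro (_ | n) hn
    · exact absurd rfl hn
    · change ‖(0 : (BanachRep.zeroRep G).E)‖ₑ * ‖(0 : StrongDual ℂ (BanachRep.zeroRep G).E)‖ₑ = 0
      simp

/-- On a compact group every coefficient function satisfies `‖⟨π(·)ξ, φ⟩‖ ≤ ‖ξ‖ ‖φ‖`, because it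
is already a coefficient of the cyclic subrepresentation generated by `ξ`. -/
theorem bpNorm_coeff_le {K : Type u} [Group K] [TopologicalSpace K]
    [IsTopologicalGroup K] [CompactSpace K] {p : ℝ≥0∞} {π : BanachRep K}
    (hπ : π.IsRep p.conjExponent) (ξ : π.E) (φ : StrongDual ℂ π.E) :
    bpNorm p (π.coeff ξ φ) ≤ ENNReal.ofReal (‖ξ‖ * ‖φ‖) := by
  rw [ENNReal.ofReal_mul (norm_nonneg _), ofReal_norm, ofReal_norm]
  obtain ⟨σ, η, ψ, hσ, hc, heq, hle⟩ := BanachRep.exists_isCyclic_coeff_eq hπ ξ φ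
  rw [← heq]
  exact (bpNorm_coeff_le_of_isCyclic hσ hc η ψ).trans hle

/-! ### The regular representation on `L^q` -/

theorem conjExponent_ne_top {p : ℝ≥0∞} (hp : 1 < p) : p.conjExponent ≠ ∞ := by
  simp [ENNReal.conjExponent, tsub_eq_zero_iff_le, hp]

section Regular

variable {G : Type u} [Group G] [TopologicalSpace G] [IsTopologicalGroup G] [LocallyCompactSpace G]
  [MeasurableSpace G] [BorelSpace G]

/-- The left regular representation `(λ(x)f)(z) = f(x⁻¹z)` on `L^q(G)`, `q < ∞`. -/
noncomputable def regularRep (G : Type u) [Group G] [TopologicalSpace G] [IsTopologicalGroup G]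
    [LocallyCompactSpace G] [MeasurableSpace G] [BorelSpace G] (q : ℝ≥0∞) [Fact (1 ≤ q)]
    [Fact (q ≠ ∞)] : BanachRep G where
  E := Lp ℂ q (Measure.haar : Measure G)
  toHom := MonoidHom.mk' (fun x =>
    { DistribMulAction.toLinearEquiv ℂ (Lp ℂ q (Measure.haar : Measure G))
        (DomMulAct.mk x⁻¹) with
      norm_map' := fun f => DomMulAct.norm_smul_Lp _ f })
    fun x y => LinearIsometryEquiv.ext fun f => by
      change DomMulAct.mk (x * y)⁻¹ • f = DomMulAct.mk x⁻¹ • DomMulAct.mk y⁻¹ • f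
      rw [smul_smul, ← DomMulAct.mk_mul, mul_inv_rev]
  strongly_continuous f := by
    change Continuous fun x : G => DomMulAct.mk x⁻¹ • f
    exact (DomMulAct.continuous_mk.comp continuous_inv).smul continuous_const

theorem isRep_regularRep (q : ℝ≥0∞) [Fact (1 ≤ q)] [Fact (q ≠ ∞)] : (regularRep G q).IsRep q :=
  isQSL_Lp _ q

/-- The functional `f ↦ ∫ g f` on `L^q(G)` given by `g ∈ L^p(G)`, linearly in `g`. -/
noncomputable def regularDual (G : Type u) [Group G] [TopologicalSpace G] [IsTopologicalGroup G]
    [LocallyCompactSpace G] [MeasurableSpace G] [BorelSpace G] (p q : ℝ≥0∞) [Fact (1 ≤ p)]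
    [Fact (1 ≤ q)] [p.HolderConjugate q] [Fact (q ≠ ∞)] :
    Lp ℂ p (Measure.haar : Measure G) →L[ℂ] StrongDual ℂ (regularRep G q).E :=
  (ContinuousLinearMap.mul ℂ ℂ).lpPairing Measure.haar p q

theorem coeff_regularRep {p q : ℝ≥0∞} [Fact (1 ≤ p)] [Fact (1 ≤ q)] [p.HolderConjugate q]
    [Fact (q ≠ ∞)] {f g : G → ℂ} (hf : MemLp f q (Measure.haar : Measure G))
    (hg : MemLp g p (Measure.haar : Measure G)) (x : G) :
    (regularRep G q).coeff (hf.toLp f) (regularDual G p q (hg.toLp g)) x =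
      ∫ z, g z * f (x⁻¹ * z) ∂(Measure.haar : Measure G) := by
  refine (ContinuousLinearMap.lpPairing_eq_integral ..).trans (integral_congr_ae ?_)
  have h1 := DomMulAct.smul_Lp_ae_eq (DomMulAct.mk x⁻¹) (hf.toLp f)
  have h2 : ∀ᵐ z ∂(Measure.haar : Measure G), hf.toLp f (x⁻¹ * z) = f (x⁻¹ * z) :=
    (measurePreserving_mul_left _ x⁻¹).quasiMeasurePreserving.ae hf.coeFn_toLp
  filter_upwards [h1, h2, hg.coeFn_toLp] with z h1 h2 h3
  rw [ContinuousLinearMap.mul_apply', h3]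
  exact congrArg _ (h1.trans h2)

end Regular

/-- On a compact group, averages of right translates of `a` over a fixed set of positive measure
are controlled in the norm of `B_p` by the supremum of `|a|`: they are the coefficients of the
regular representation at the normalised indicator of `V` and at `a`. -/
theorem exists_bpNorm_average_le {K : Type u} [Group K] [TopologicalSpace K]
    [IsTopologicalGroup K] [CompactSpace K] [MeasurableSpace K] [BorelSpace K] {p : ℝ≥0∞}
    (hp : 1 < p) {V : Set K} (hV : MeasurableSet V) :
    ∃ C : ℝ, 0 ≤ C ∧ ∀ (a : K → ℂ) (δ : ℝ), Continuous a → (∀ x, ‖a x‖ ≤ δ) →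
      bpNorm p (fun x => ⨍ y in V, a (x * y) ∂(Measure.haar : Measure K)) ≤
        ENNReal.ofReal (C * δ) := by
  have : Fact (1 ≤ p) := ⟨hp.le⟩
  have : Fact (p.conjExponent ≠ ∞) := ⟨conjExponent_ne_top hp⟩
  let c : ℂ := ((Measure.haar : Measure K).real V)⁻¹
  have hη : MemLp (V.indicator fun _ => c) p.conjExponent (Measure.haar : Measure K) :=
    memLp_indicator_const _ hV _ (Or.inr (measure_ne_top _ _))
  refine ⟨‖hη.toLp‖ * (‖regularDual K p p.conjExponent‖ *
    (measureUnivNNReal (Measure.haar : Measure K) : ℝ) ^ p.toReal⁻¹), by positivity,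
    fun a δ ha hδ => ?_⟩
  have hδ0 : 0 ≤ δ := (norm_nonneg _).trans (hδ 1)
  have ha' : MemLp a p (Measure.haar : Measure K) :=
    ha.memLp_of_hasCompactSupport (HasCompactSupport.of_compactSpace _)
  have hcoeff : (fun x => ⨍ y in V, a (x * y) ∂(Measure.haar : Measure K)) =
      (regularRep K p.conjExponent).coeff (hη.toLp _)
        (regularDual K p p.conjExponent (ha'.toLp a)) := by
    funext x
    rw [coeff_regularRep hη ha', setAverage_eq, ← integral_indicator hV, ← integral_smul]
    refine Eq.trans ?_ (integral_mul_left_eq_self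
      (fun z => a z * V.indicator (fun _ => c) (x⁻¹ * z)) x)
    refine integral_congr_ae (Filter.Eventually.of_forall fun y => ?_)
    by_cases hy : y ∈ V
    · simp [hy, c, mul_comm]
    · simp [hy]
  rw [hcoeff]
  have hnorm : ‖regularDual K p p.conjExponent (ha'.toLp a)‖ ≤ ‖regularDual K p p.conjExponent‖ *
      ((measureUnivNNReal (Measure.haar : Measure K) : ℝ) ^ p.toReal⁻¹ * δ) := by
    refine ((regularDual K p p.conjExponent).le_opNorm _).trans ?_
    refine mul_le_mul_of_nonneg_left (Lp.norm_le_of_ae_bound hδ0 ?_) (norm_nonneg _)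
    filter_upwards [ha'.coeFn_toLp] with x hx
    rw [hx]
    exact hδ x
  refine (bpNorm_coeff_le (isRep_regularRep _) _ _).trans (ENNReal.ofReal_le_ofReal ?_)
  refine (mul_le_mul_of_nonneg_left hnorm (norm_nonneg _)).trans_eq ?_
  rw [mul_assoc, mul_assoc]
  rfl

/-! ### Uniform approximation on compact sets by coefficients -/

/-- A continuous function on a compact subset of a locally compact Hausdorff space extends to a
compactly supported continuous function. -/
theorem exists_continuous_hasCompactSupport_eqOn {X : Type*} [TopologicalSpace X] [T2Space X]
    [LocallyCompactSpace X] {s : Set X} (hs : IsCompact s) {v : s → ℂ} (hv : Continuous v) :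
    ∃ h : X → ℂ, Continuous h ∧ HasCompactSupport h ∧ ∀ x : s, h x = v x := by
  -- The space need not be normal, so the extension is made inside the compact set `k` and then cut
  -- off by `χ`, which vanishes outside `k' ⊆ interior k`.
  obtain ⟨k', hk', hsk'⟩ := exists_compact_superset hs
  obtain ⟨k, hk, hkk⟩ := exists_compact_superset hk'
  obtain ⟨χ, hχ1, hχ0, -, -⟩ := exists_continuous_one_zero_of_isCompact hs
    isOpen_interior.isClosed_compl (Set.disjoint_compl_right_iff_subset.2 hsk')
  have hsk : s ⊆ k := hsk'.trans (interior_subset.trans (hkk.trans interior_subset))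
  have : CompactSpace k := isCompact_iff_compactSpace.1 hk
  have : CompactSpace s := isCompact_iff_compactSpace.1 hs
  let i : s → k := Set.inclusion hsk
  have hi : Topology.IsClosedEmbedding i :=
    (continuous_inclusion _).isClosedEmbedding (Set.inclusion_injective _)
  obtain ⟨g, hg⟩ := (ContinuousMap.mk v hv).exists_extension' hi
  classical
  let h : X → ℂ := fun x => if hx : x ∈ k then χ x * g ⟨x, hx⟩ else 0
  have hzero : ∀ x, x ∉ k' → h x = 0 := fun x hx => by
    have : χ x = 0 := hχ0 fun hx' => hx (interior_subset hx')
    simp [h, this]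
  have hk_cont : ContinuousOn h k := by
    rw [continuousOn_iff_continuous_domRestrict]
    refine Continuous.congr (f := fun x : k => (χ x : ℂ) * g x) (by fun_prop) fun x => ?_
    simp [h]
  refine ⟨h, continuous_iff_continuousAt.2 fun x => ?_, HasCompactSupport.intro hk' hzero, ?_⟩
  · by_cases hx : x ∈ k'
    · exact hk_cont.continuousAt (mem_interior_iff_mem_nhds.1 (hkk hx))
    · exact continuousAt_const.congr (Filter.eventuallyEq_of_mem
        (hk'.isClosed.isOpen_compl.mem_nhds hx) fun y hy => (hzero y hy).symm)
  · intro x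
    have h1 : χ x = 1 := hχ1 x.2
    have h2 : g ⟨x, hsk x.2⟩ = v x := congrFun hg x
    simp [h, hsk x.2, h1, h2]

/-- Coefficients of representations on `QSL`-spaces approximate every continuous function
uniformly on compact sets: the regular representation has the coefficients
`x ↦ ⨍ z in k, h (z⁻¹ * x)`, for `h` continuous with compact support and `k` a compact
neighbourhood of the identity, and these tend to `h` as `k` shrinks. -/
theorem exists_coeff_approx_on_compact {G : Type u} [Group G] [TopologicalSpace G]
    [IsTopologicalGroup G] [LocallyCompactSpace G] [T2Space G] {p : ℝ≥0∞} (hp : 1 < p) {s : Set G}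
    (hs : IsCompact s) {v : s → ℂ} (hv : Continuous v) {δ : ℝ} (hδ : 0 < δ) :
    ∃ π : BanachRep G, π.IsRep p.conjExponent ∧
      ∃ (ξ : π.E) (φ : StrongDual ℂ π.E), ∀ x : s, ‖π.coeff ξ φ x - v x‖ ≤ δ := by
  let _ : MeasurableSpace G := borel G
  have : BorelSpace G := ⟨rfl⟩
  have : Fact (1 ≤ p) := ⟨hp.le⟩
  have : Fact (p.conjExponent ≠ ∞) := ⟨conjExponent_ne_top hp⟩
  obtain ⟨h, hc, hsupp, hvh⟩ := exists_continuous_hasCompactSupport_eqOn hs hv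
  have hnear : ∀ᶠ z in nhds (1 : G), ∀ x ∈ s, ‖h (z⁻¹ * x) - h x‖ < δ := by
    refine hs.eventually_forall_of_forall_eventually (fun x _ => ?_)
    have : Continuous fun w : G × G => ‖h (w.1⁻¹ * w.2) - h w.2‖ := by fun_prop
    refine this.continuousAt.eventually_lt continuousAt_const ?_
    simpa using hδ
  obtain ⟨k, hk1, hkU, hk⟩ := local_compact_nhds hnear
  have hk0 : (Measure.haar : Measure G) k ≠ 0 := (Measure.measure_pos_of_mem_nhds _ hk1).ne'
  let c : ℂ := ((Measure.haar : Measure G).real k)⁻¹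
  have hg : MemLp (k.indicator fun _ => c) p (Measure.haar : Measure G) :=
    memLp_indicator_const _ hk.measurableSet _ (Or.inr hk.measure_ne_top)
  have hf : MemLp (fun z => h z⁻¹) p.conjExponent (Measure.haar : Measure G) :=
    (hc.comp continuous_inv).memLp_of_hasCompactSupport
      (hsupp.comp_homeomorph (Homeomorph.inv G))
  refine ⟨regularRep G p.conjExponent, isRep_regularRep _, hf.toLp _,
    regularDual G p p.conjExponent (hg.toLp _), fun x => ?_⟩
  have hcoeff : (regularRep G p.conjExponent).coeff (hf.toLp _)
      (regularDual G p p.conjExponent (hg.toLp _)) x =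
        ⨍ z in k, h (z⁻¹ * x) ∂(Measure.haar : Measure G) := by
    rw [coeff_regularRep hf hg, setAverage_eq, ← integral_indicator hk.measurableSet,
      ← integral_smul]
    refine integral_congr_ae (Filter.Eventually.of_forall fun z => ?_)
    by_cases hz : z ∈ k
    · simp [hz, c]
    · simp [hz]
  rw [hcoeff]
  refine mem_closedBall_iff_norm.1 ((convex_closedBall (v x) δ).set_average_mem
    Metric.isClosed_closedBall hk0 hk.measure_ne_top ((ae_restrict_iff' hk.measurableSet).2
      (Filter.Eventually.of_forall fun z hz => ?_)) ?_)
  · rw [mem_closedBall_iff_norm, ← hvh]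
    exact (hkU hz x x.2).le
  · exact ContinuousOn.integrableOn_compact hk (by fun_prop)

/-! ### Density of the range of the restriction map -/

/-- For a compact normal subgroup `N` of a locally compact (Hausdorff) group `G` and
`1 < p < ∞`, the restriction map `r : B_p(G) → B_p(N)` has dense range for the norm topology. -/
theorem mainTheorem2 (p : ℝ≥0∞) (hp : 1 < p) (hp' : p < ∞)
    (G : Type u) [Group G] [TopologicalSpace G] [IsTopologicalGroup G] [LocallyCompactSpace G]
    [T2Space G] (N : Subgroup G) [N.Normal] [CompactSpace N] :
    DenseRange (Bp.restrict p N : Bp p G → Bp p N) := by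
  let _ : MeasurableSpace N := borel N
  have : BorelSpace N := ⟨rfl⟩
  intro v
  refine EMetric.mem_closure_iff.2 fun ε hε => ?_
  obtain ⟨r, hr0, hrε⟩ := ENNReal.lt_iff_exists_nnreal_btwn.1 hε
  have hr : (0 : ℝ) < r := by exact_mod_cast hr0
  obtain ⟨π, hπ, ξ, φ, hv⟩ := v.exists_coeff
  have hvc : Continuous v.toFun := hv ▸ φ.continuous.comp (π.strongly_continuous ξ)
  -- `V` is a neighbourhood of the identity so small that averaging `v` over the translates by `V`
  -- costs at most `r / 2`; it is fixed before the uniform approximation, whose precision depends on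
  -- the constant `C` belonging to `V`.
  let V : Set N := (fun y => π.toHom y ξ) ⁻¹' Metric.ball ξ (r / 2 / (‖φ‖ + 1))
  have hVo : IsOpen V := Metric.isOpen_ball.preimage (π.strongly_continuous ξ)
  have hV0 : (Measure.haar : Measure N) V ≠ 0 :=
    hVo.measure_ne_zero _ ⟨1, by
      simp only [V, Set.mem_preimage, map_one]
      exact Metric.mem_ball_self (by positivity)⟩
  obtain ⟨C, hC0, hC⟩ := exists_bpNorm_average_le hp hVo.measurableSet
  obtain ⟨σ, hσ, η, ψ, hη⟩ := exists_coeff_approx_on_compact hp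
    (isCompact_iff_compactSpace.2 ‹CompactSpace N›) hvc (δ := r / 2 / (C + 1)) (by positivity)
  have hσc : Continuous ((σ.restrict N).coeff η ψ) :=
    ψ.continuous.comp ((σ.restrict N).strongly_continuous η)
  let u : Bp p G := ⟨σ.coeff (⨍ y in V, (σ.restrict N).toHom y η ∂(Measure.haar : Measure N)) ψ,
    σ, hσ, _, _, rfl⟩
  refine ⟨_, ⟨u, rfl⟩, ?_⟩
  have hu : (u.restrict p N).toFun =
      fun x => ⨍ y in V, (σ.restrict N).coeff η ψ (x * y) ∂(Measure.haar : Measure N) :=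
    funext fun x => (σ.restrict N).coeff_average_orbit η ψ V x
  have hsplit : v.toFun - (u.restrict p N).toFun =
      (fun x => ⨍ y in V, (v.toFun - (σ.restrict N).coeff η ψ) (x * y)
        ∂(Measure.haar : Measure N)) +
      π.coeff (ξ - ⨍ y in V, π.toHom y ξ ∂(Measure.haar : Measure N)) φ := by
    have hi : ∀ {f : N → ℂ}, Continuous f → ∀ x, Integrable (fun y => f (x * y))
        ((Measure.haar : Measure N).restrict V) := fun hf x =>
      (hf.comp (continuous_const_mul x)).integrable_haar_of_compactSpace.integrableOn
    funext x
    have h1 : π.coeff (ξ - ⨍ y in V, π.toHom y ξ ∂(Measure.haar : Measure N)) φ x =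
        v.toFun x - ⨍ y in V, v.toFun (x * y) ∂(Measure.haar : Measure N) := by
      rw [hv, ← π.coeff_average_orbit]
      simp [BanachRep.coeff]
    rw [hu, Pi.add_apply, h1]
    simp only [Pi.sub_apply, setAverage_eq]
    rw [integral_sub (hi hvc x) (hi hσc x), smul_sub]
    ring
  change bpNorm p (v.toFun - (u.restrict p N).toFun) < ε
  rw [hsplit]
  refine (bpNorm_add_le p _ _).trans_lt (lt_of_le_of_lt ?_ hrε)
  have hsum : (r : ℝ≥0∞) = ENNReal.ofReal (r / 2) + ENNReal.ofReal (r / 2) := by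
    rw [← ENNReal.ofReal_add (by positivity) (by positivity), add_halves,
      ENNReal.ofReal_coe_nnreal]
  rw [hsum]
  refine add_le_add
    ((hC _ (r / 2 / (C + 1)) (hvc.sub hσc) fun x => ?_).trans (ENNReal.ofReal_le_ofReal ?_))
    ((bpNorm_coeff_le hπ _ _).trans (ENNReal.ofReal_le_ofReal ?_))
  · rw [Pi.sub_apply, norm_sub_rev]
    exact hη x
  · rw [mul_div_left_comm]
    exact mul_le_of_le_one_right (by positivity) ((div_le_one (by positivity)).2 (by linarith))
  · have h2 := π.norm_average_orbit_sub_le ξ hVo.measurableSet hV0 fun y hy =>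
      (mem_ball_iff_norm.1 hy).le
    rw [norm_sub_rev] at h2
    refine (mul_le_mul_of_nonneg_right h2 (norm_nonneg _)).trans ?_
    rw [div_mul_eq_mul_div, mul_div_assoc]
    exact mul_le_of_le_one_right (by positivity) ((div_le_one (by positivity)).2 (by linarith))
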